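/- All rings and algebras are commutative. For a ring $R$, an $R$-algebra $A$, an integer $n\ge 0$ and a subgroup $G\subseteq S_n$, let $G$ act on $A^{\otimes n}=A^{\otimes_R n}$ by permuting the tensor factors, and let $(A^{\otimes n})^G$ be the subalgebra of invariants. For $a\in A$ write $a^{(j)}$ for the pure tensor with $a$ in position $j$ and $1$ elsewhere. If $A$ is free of rank $n$ as an $R$-module, the Ferrand homomorphism $\mathrm{Ferrand}_A\colon (A^{\otimes n})^{S_n}\to R$ is the $R$-algebra homomorphism determined by $\alpha\cdot(b_1\wedge\dots\wedge b_n)=\mathrm{Ferrand}_A(\alpha)\,(b_1\wedge\dots\wedge b_n)$ for any basis $b_1,\dots,b_n$ of $A$, where the left side denotes the image of $\alpha\cdot(b_1\otimes\dots\otimes b_n)$ in $\bigwedge^n A$; it sends the $k$-th elementary symmetric polynomial in $a^{(1)},\dots,a^{(n)}$ to $s_k(a)$, where $\lambda^n-s_1(a)\lambda^{n-1}+\dots+(-1)^ns_n(a)$ is the characteristic polynomial of multiplication by $a$. A $G$-closure datum for $A$ over $R$ is an $R$-algebra homomorphism $\varphi\colon (A^{\otimes n})^G\to R$ that extends $\mathrm{Ferrand}_A$,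 and its closure algebra is $A^{\otimes n}/\varphi:=A^{\otimes n}/\bigl(\alpha-\varphi(\alpha):\alpha\in (A^{\otimes n})^G\bigr)$. **Theorem.** Let $R$ be a ring, let $f\in R[x]$ be monic of degree $n$, let $n_1,\dots,n_k\ge 0$ be integers with $n_1+\dots+n_k=n$, and put $A=R[x]/(f)$. Regard $S_{n_1}\times\dots\times S_{n_k}$ as the subgroup of $S_n$ that preserves each of the consecutive blocks $\{n_1+\dots+n_{i-1}+1,\dots,n_1+\dots+n_i\}$. There is a bijection between the $S_{n_1}\times\dots\times S_{n_k}$-closure data $\varphi$ for $A$ over $R$ and the ordered factorizations $f=f_1\cdots f_k$ in $R[x]$ into monic factors of degrees $n_1,\dots,n_k$, given as follows. (a) The factorization corresponding to $\varphi$ has $f_i(\lambda)$ equal to the image under $\varphi$, applied coefficientwise, of $\prod_j(\lambda-x^{(j)})$, where $j$ runs over the $i$-th block. (b) The closure datum corresponding to $f=f_1\cdots f_k$ is the composite $$(A^{\otimes n})^{S_{n_1}\times\dots\times S_{n_k}}\cong\bigotimes_{i}(A^{\otimes n_i})^{S_{n_i}}\to\bigotimes_{i}(A_i^{\otimes n_i})^{S_{n_i}}\to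 R,\qquad A_i=R[x]/(f_i),$$ that is, for all $\alpha_i\in(A^{\otimes n_i})^{S_{n_i}}$ it sends $\alpha_1\otimes\dots\otimes\alpha_k$ to $\prod_i\mathrm{Ferrand}_{A_i}(\bar\alpha_i)$, where $\bar\alpha_i$ is the image of $\alpha_i$ in $A_i^{\otimes n_i}$. Moreover, the closure algebra of the closure datum $\varphi$ corresponding to $f=f_1\cdots f_k$ is isomorphic as an $R$-algebra to $$\bigotimes_{i=1}^k\bigl(A_i^{\otimes n_i}/\mathrm{Ferrand}_{A_i}\bigr).$$ -/

import Mathlib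

open Polynomial
open scoped TensorProduct

namespace ClosureData

section General

variable {R : Type*} [CommRing R] {A : Type*} [CommRing A] [Algebra R A]
  {B : Type*} [CommRing B] [Algebra R B]

/-- The algebra homomorphism `A^{⊗κ} → B^{⊗ι}` induced by an algebra homomorphism `p : A → B` and
a map `g : κ → ι` of index sets. It sends `a^{(k)}` (the pure tensor with `a` in position `k` and
`1` elsewhere) to `p(a)^{(g k)}`, hence `⊗_k a_k` to `∏_k p(a_k)^{(g k)}`. -/
noncomputable def tensorMap {κ ι : Type*} [Fintype κ] [DecidableEq ι] (p : A →ₐ[R] B)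
    (g : κ → ι) : (⨂[R] _ : κ, A) →ₐ[R] (⨂[R] _ : ι, B) :=
  PiTensorProduct.liftAlgHom
    ((MultilinearMap.mkPiAlgebra R κ (⨂[R] _ : ι, B)).compLinearMap
      fun k => ((PiTensorProduct.singleAlgHom (R := R) (A := fun _ : ι => B) (g k)).comp
        p).toLinearMap)
    (by simp only [MultilinearMap.compLinearMap_apply, MultilinearMap.mkPiAlgebra_apply,
          AlgHom.toLinearMap_apply, Pi.one_apply, map_one, Finset.prod_const_one])
    (fun x y => by
      simp only [MultilinearMap.compLinearMap_apply, MultilinearMap.mkPiAlgebra_apply,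
        AlgHom.toLinearMap_apply, Pi.mul_apply, map_mul, Finset.prod_mul_distrib])

theorem tensorMap_tprod {κ ι : Type*} [Fintype κ] [DecidableEq ι] (p : A →ₐ[R] B) (g : κ → ι)
    (v : κ → A) : tensorMap p g (PiTensorProduct.tprod R v) =
      ∏ k, PiTensorProduct.singleAlgHom (R := R) (A := fun _ : ι => B) (g k) (p (v k)) := by
  simp [tensorMap, MultilinearMap.mkPiAlgebra_apply, -PiTensorProduct.singleAlgHom_apply]

theorem tprod_eq_prod {ι : Type*} [Fintype ι] [DecidableEq ι] (v : ι → A) :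
    PiTensorProduct.tprod R v =
      ∏ k, PiTensorProduct.singleAlgHom (R := R) (A := fun _ : ι => A) k (v k) := by
  simp only [PiTensorProduct.singleAlgHom_apply, MonoidHom.mulSingle_apply]
  rw [← PiTensorProduct.tprod_prod, Finset.univ_prod_mulSingle]

theorem tensorMap_single {κ ι : Type*} [Fintype κ] [DecidableEq κ] [DecidableEq ι]
    (p : A →ₐ[R] B) (g : κ → ι) (k : κ) (a : A) :
    tensorMap p g (PiTensorProduct.singleAlgHom (R := R) (A := fun _ : κ => A) k a) =
      PiTensorProduct.singleAlgHom (R := R) (A := fun _ : ι => B) (g k) (p a) := by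
  rw [PiTensorProduct.singleAlgHom_apply, tensorMap_tprod, Finset.prod_eq_single k]
  · simp
  · intro j _ hj
    simp only [MonoidHom.mulSingle_apply, Pi.mulSingle_eq_of_ne hj, map_one]
  · simp

theorem tensorMap_perm_tprod {ι : Type*} [Fintype ι] [DecidableEq ι] (σ : Equiv.Perm ι)
    (v : ι → A) : tensorMap (AlgHom.id R A) σ (PiTensorProduct.tprod R v) =
      PiTensorProduct.tprod R (v ∘ σ.symm) := by
  rw [tensorMap_tprod, tprod_eq_prod]
  exact Fintype.prod_equiv σ _ _ (fun k => by simp)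

variable (R A) in
/-- The subalgebra `(A^{⊗n})^G` of tensors fixed by a group `G` of permutations of the tensor
factors, where `σ` sends `a^{(i)}` to `a^{(σ i)}`. -/
noncomputable def invariants {n : ℕ} (G : Subgroup (Equiv.Perm (Fin n))) :
    Subalgebra R (⨂[R] _ : Fin n, A) :=
  ⨅ σ ∈ G, AlgHom.equalizer (tensorMap (AlgHom.id R A) σ) (AlgHom.id R (⨂[R] _ : Fin n, A))

theorem mem_invariants {n : ℕ} {G : Subgroup (Equiv.Perm (Fin n))} {α : ⨂[R] _ : Fin n, A} :
    α ∈ invariants R A G ↔ ∀ σ ∈ G, tensorMap (AlgHom.id R A) σ α = α := by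
  simp [invariants, Algebra.mem_iInf, AlgHom.mem_equalizer]

theorem invariants_anti {n : ℕ} {G H : Subgroup (Equiv.Perm (Fin n))} (h : G ≤ H) :
    invariants R A H ≤ invariants R A G := fun _ hα =>
  mem_invariants.2 fun σ hσ => mem_invariants.1 hα σ (h hσ)

theorem tensorMap_mem_invariants {n : ℕ} (p : A →ₐ[R] B) {G : Subgroup (Equiv.Perm (Fin n))}
    {α : ⨂[R] _ : Fin n, A} (hα : α ∈ invariants R A G) :
    tensorMap p id α ∈ invariants R B G := by
  refine mem_invariants.2 fun σ hσ => ?_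
  have h : (tensorMap (AlgHom.id R B) σ).comp (tensorMap p id) =
      (tensorMap p id).comp (tensorMap (AlgHom.id R A) (σ : Fin n → Fin n)) := by
    ext i a
    simp only [AlgHom.comp_apply, tensorMap_single, id, AlgHom.id_apply]
  conv_rhs => rw [← mem_invariants.1 hα σ hσ]
  exact DFunLike.congr_fun h α

/-- The homomorphism `(A^{⊗n})^G → (B^{⊗n})^G` induced by `p : A → B`. -/
noncomputable def mapInvariants {n : ℕ} (p : A →ₐ[R] B) (G : Subgroup (Equiv.Perm (Fin n))) :
    invariants R A G →ₐ[R] invariants R B G :=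
  ((tensorMap p (id : Fin n → Fin n)).comp (invariants R A G).val).codRestrict _
    fun α => tensorMap_mem_invariants p α.2

/-- The linear form `D_b : A^{⊗n} → R`, `a₁ ⊗ ⋯ ⊗ aₙ ↦ det_b(a₁, …, aₙ)`, i.e. the projection
`A^{⊗n} → ⋀ⁿ A` followed by the coordinate with respect to `b₁ ∧ ⋯ ∧ bₙ`. -/
noncomputable def detForm {n : ℕ} (b : Module.Basis (Fin n) R A) :
    (⨂[R] _ : Fin n, A) →ₗ[R] R :=
  PiTensorProduct.lift b.det.toMultilinearMap

theorem detForm_tprod {n : ℕ} (b : Module.Basis (Fin n) R A) (v : Fin n → A) :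
    detForm b (PiTensorProduct.tprod R v) = b.det v := by
  simp [detForm]

theorem detForm_mul_alternating {n : ℕ} (b : Module.Basis (Fin n) R A)
    {α : ⨂[R] _ : Fin n, A} (hα : α ∈ invariants R A (⊤ : Subgroup (Equiv.Perm (Fin n))))
    (v : Fin n → A) {i j : Fin n} (hv : v i = v j) (hij : i ≠ j) :
    detForm b (α * PiTensorProduct.tprod R v) = 0 := by
  classical
  set c := Basis.piTensorProduct (R := R) (fun _ : Fin n => b) with hc
  set σ := Equiv.swap i j with hσ
  have hσσ : ∀ k, σ (σ k) = k := Equiv.swap_apply_self i j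
  have hvσ : ∀ k, v (σ k) = v k := by
    intro k
    by_cases h1 : k = i
    · subst h1; simp [hσ, hv]
    · by_cases h2 : k = j
      · subst h2; simp [hσ, hv]
      · rw [hσ, Equiv.swap_apply_of_ne_of_ne h1 h2]
  have hcoef : ∀ p : Fin n → Fin n, c.repr α (p ∘ σ) = c.repr α p := by
    intro p
    have h : (c.coord p).comp (tensorMap (AlgHom.id R A) (σ : Fin n → Fin n)).toLinearMap =
        c.coord (p ∘ σ) := by
      refine PiTensorProduct.ext (MultilinearMap.ext fun w => ?_)
      simp only [LinearMap.compMultilinearMap_apply, LinearMap.comp_apply,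
        AlgHom.toLinearMap_apply, tensorMap_perm_tprod, Module.Basis.coord_apply, hc,
        Basis.piTensorProduct_repr_tprod_apply]
      exact (Fintype.prod_equiv σ _ _ (fun k => by simp)).symm
    have := DFunLike.congr_fun h α
    simp only [LinearMap.comp_apply, AlgHom.toLinearMap_apply,
      mem_invariants.1 hα σ (Subgroup.mem_top _), Module.Basis.coord_apply] at this
    exact this.symm
  have hα' : α * PiTensorProduct.tprod R v =
      ∑ p, c.repr α p • PiTensorProduct.tprod R (fun k => b (p k) * v k) := by
    conv_lhs => rw [← c.sum_repr α]
    rw [Finset.sum_mul]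
    refine Finset.sum_congr rfl fun p _ => ?_
    rw [smul_mul_assoc, hc, Basis.piTensorProduct_apply, PiTensorProduct.tprod_mul_tprod]
    rfl
  rw [hα', map_sum]
  have key : ∀ p : Fin n → Fin n, b.det (fun k => b ((p ∘ σ) k) * v k) =
      - b.det (fun k => b (p k) * v k) := by
    intro p
    rw [← b.det.map_swap _ hij]
    congr 1
    funext k
    simp only [Function.comp_apply, ← hσ, hvσ]
  refine Finset.sum_involution (fun p _ => p ∘ σ) ?_ ?_ (fun _ _ => Finset.mem_univ _) ?_
  · intro p _
    simp only [map_smul, detForm_tprod, hcoef, key, smul_neg, add_neg_cancel]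
  · intro p _ hne heq
    apply hne
    rw [map_smul, detForm_tprod, b.det.map_eq_zero_of_eq _ (i := i) (j := j) _ hij, smul_zero]
    have : p j = p i := by
      have := congrFun heq i
      simpa [hσ] using this
    simp only [this, hv]
  · intro p _
    funext k
    simp [hσσ]

/-- A symmetric tensor `α` acts on `⋀ⁿ A` through a scalar, namely `D_b(α · (b₁ ⊗ ⋯ ⊗ bₙ))`. -/
theorem detForm_mul {n : ℕ} (b : Module.Basis (Fin n) R A)
    {α : ⨂[R] _ : Fin n, A} (hα : α ∈ invariants R A (⊤ : Subgroup (Equiv.Perm (Fin n))))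
    (β : ⨂[R] _ : Fin n, A) :
    detForm b (α * β) = detForm b (α * PiTensorProduct.tprod R b) * detForm b β := by
  let m : A [⋀^Fin n]→ₗ[R] R :=
    { ((detForm b).comp (LinearMap.mulLeft R α)).compMultilinearMap (PiTensorProduct.tprod R) with
      map_eq_zero_of_eq' := fun v i j hv hij => detForm_mul_alternating b hα v hv hij }
  have hm : ∀ v, m v = detForm b (α * PiTensorProduct.tprod R v) := fun v => rfl
  have h : (detForm b).comp (LinearMap.mulLeft R α) =
      detForm b (α * PiTensorProduct.tprod R b) • detForm b := by
    refine PiTensorProduct.ext (MultilinearMap.ext fun v => ?_)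
    have := DFunLike.congr_fun (m.eq_smul_basis_det b) v
    simpa [hm, detForm_tprod] using this
  exact DFunLike.congr_fun h β

/-- The Ferrand homomorphism computed in a basis `b`: the element `Φ(α)` of `R` for which
`α · (b₁ ∧ ⋯ ∧ bₙ) = Φ(α) · (b₁ ∧ ⋯ ∧ bₙ)` in `⋀ⁿ A`. -/
noncomputable def ferrandOfBasis {n : ℕ} (b : Module.Basis (Fin n) R A) :
    invariants R A (⊤ : Subgroup (Equiv.Perm (Fin n))) →ₐ[R] R :=
  AlgHom.ofLinearMap
    ((detForm b).comp ((LinearMap.mulRight R (PiTensorProduct.tprod R (b : Fin n → A))).comp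
      (invariants R A _).val.toLinearMap))
    (by simp [detForm_tprod, Module.Basis.det_self])
    (fun α β => by
      simp only [LinearMap.comp_apply, AlgHom.toLinearMap_apply, map_mul,
        LinearMap.mulRight_apply, mul_assoc]
      exact detForm_mul b α.2 _)

theorem ferrandOfBasis_apply {n : ℕ} (b : Module.Basis (Fin n) R A)
    (α : invariants R A (⊤ : Subgroup (Equiv.Perm (Fin n)))) :
    ferrandOfBasis b α = detForm b (α * PiTensorProduct.tprod R b) := rfl

/-- The Ferrand homomorphism does not depend on the basis. -/
theorem ferrandOfBasis_eq {n : ℕ} (b b' : Module.Basis (Fin n) R A) :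
    ferrandOfBasis b = ferrandOfBasis b' := by
  ext α
  have h1 : ∀ β, detForm b' β = b'.det b * detForm b β := by
    intro β
    have : detForm b' = b'.det b • detForm b := by
      refine PiTensorProduct.ext (MultilinearMap.ext fun v => ?_)
      have := DFunLike.congr_fun (b'.det.eq_smul_basis_det b) v
      simpa [detForm_tprod] using this
    simp [this]
  have h2 : b'.det b * b.det b' = 1 := by
    have := h1 (PiTensorProduct.tprod R b')
    rw [detForm_tprod, detForm_tprod, Module.Basis.det_self] at this
    exact this.symm
  rw [ferrandOfBasis_apply, ferrandOfBasis_apply, h1, detForm_mul b α.2 (PiTensorProduct.tprod R b'),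
    detForm_tprod, mul_left_comm, h2, mul_one]

variable (R A) in
/-- `A` is free of rank `n` as an `R`-module. -/
def IsFreeOfRank (n : ℕ) : Prop := Nonempty (Module.Basis (Fin n) R A)

/-- The Ferrand homomorphism `(A^{⊗n})^{Sₙ} → R` of an `R`-algebra `A` that is free of rank `n`. -/
noncomputable def ferrand {n : ℕ} (h : IsFreeOfRank R A n) :
    invariants R A (⊤ : Subgroup (Equiv.Perm (Fin n))) →ₐ[R] R :=
  ferrandOfBasis (Classical.choice h)

theorem ferrand_eq {n : ℕ} (h : IsFreeOfRank R A n) (b : Module.Basis (Fin n) R A) :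
    ferrand h = ferrandOfBasis b := ferrandOfBasis_eq _ _

/-- The Ferrand homomorphism sends `a ⊗ ⋯ ⊗ a` to the norm of `a`. -/
theorem ferrand_tprod {n : ℕ} (h : IsFreeOfRank R A n) (a : A)
    (ha : PiTensorProduct.tprod R (fun _ : Fin n => a) ∈ invariants R A ⊤) :
    ferrand h ⟨_, ha⟩ = Algebra.norm R a := by
  have b := Classical.choice h
  rw [ferrand_eq h b, ferrandOfBasis_apply, PiTensorProduct.tprod_mul_tprod, detForm_tprod,
    Algebra.norm_apply, ← LinearMap.det_toMatrix b, Module.Basis.det_apply]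
  congr 1
  ext i j
  simp [Module.Basis.toMatrix_apply, LinearMap.toMatrix_apply]

/-- The Ferrand homomorphism sends `e_k(a)`, the `k`-th elementary symmetric polynomial in
`a^{(1)}, …, a^{(n)}`, to `s_k(a)`, where the characteristic polynomial of multiplication by `a` is
`λ^n - s₁(a) λ^{n-1} + ⋯ + (-1)^n s_n(a)`. -/
theorem ferrand_esymm {n : ℕ} [Module.Free R A] [Module.Finite R A] (h : IsFreeOfRank R A n)
    (a : A) {k : ℕ} (hk : k ≤ n)
    (ha : ∑ s ∈ Finset.powersetCard k (Finset.univ : Finset (Fin n)), ∏ i ∈ s,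
      PiTensorProduct.singleAlgHom (R := R) (A := fun _ : Fin n => A) i a ∈ invariants R A ⊤) :
    ferrand h ⟨_, ha⟩ = (-1) ^ k * (Algebra.lmul R A a).charpoly.coeff (n - k) := by
  have b := Classical.choice h
  have hprod : ∀ s : Finset (Fin n),
      ∏ i ∈ s, PiTensorProduct.singleAlgHom (R := R) (A := fun _ : Fin n => A) i a =
        PiTensorProduct.tprod R (s.piecewise (fun _ => a) 1) := by
    intro s
    rw [tprod_eq_prod, ← Finset.prod_subset (Finset.subset_univ s)]
    · exact Finset.prod_congr rfl fun i hi => by rw [Finset.piecewise_eq_of_mem _ _ _ hi]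
    · intro i _ hi
      rw [Finset.piecewise_eq_of_notMem _ _ _ hi, Pi.one_apply, map_one]
  have hM := Matrix.charpoly_coeff_eq_sum_minors
    ((LinearMap.toMatrix b b (Algebra.lmul R A a)).transpose) k (by simpa using hk)
  rw [Matrix.charpoly_transpose, LinearMap.charpoly_toMatrix, Fintype.card_fin] at hM
  rw [hM, ← mul_assoc, ← pow_add, Even.neg_one_pow ⟨k, rfl⟩, one_mul, ferrand_eq h b,
    ferrandOfBasis_apply, Finset.sum_mul, map_sum]
  refine Finset.sum_congr rfl fun s _ => ?_
  rw [hprod, PiTensorProduct.tprod_mul_tprod, detForm_tprod,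
    ← Matrix.det_piecewise_one_eq_submatrix_det, Module.Basis.det_apply, ← Matrix.det_transpose]
  congr 1
  ext i j
  by_cases hi : i ∈ s
  · simp [Module.Basis.toMatrix_apply, LinearMap.toMatrix_apply, Finset.piecewise, hi]
  · simp [Module.Basis.toMatrix_apply, Finset.piecewise, hi, Matrix.one_apply, Finsupp.single_apply]

/-- A `G`-closure datum for an `R`-algebra `A` that is free of rank `n`: an `R`-algebra
homomorphism `(A^{⊗n})^G → R` that extends the Ferrand homomorphism. -/
structure ClosureDatum {n : ℕ} (h : IsFreeOfRank R A n) (G : Subgroup (Equiv.Perm (Fin n))) where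
  toAlgHom : invariants R A G →ₐ[R] R
  extends_ferrand :
    toAlgHom.comp (Subalgebra.inclusion (invariants_anti (le_top : G ≤ ⊤))) = ferrand h

/-- The quotient `A^{⊗n} / (α - φ(α) : α ∈ (A^{⊗n})^G)`, written `A^{⊗n}/φ`. -/
abbrev ClosureAlgebra {n : ℕ} {G : Subgroup (Equiv.Perm (Fin n))}
    (φ : invariants R A G →ₐ[R] R) : Type _ :=
  (⨂[R] _ : Fin n, A) ⧸ Ideal.span (Set.range fun α : invariants R A G =>
    (α : ⨂[R] _ : Fin n, A) - algebraMap R (⨂[R] _ : Fin n, A) (φ α))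

end General

section Young

variable {k : ℕ}

/-- The position in `{1, …, n₁ + ⋯ + n_k}` of the `j`-th element of the `i`-th block of consecutive
elements, of size `n i`. -/
def blockPos (n : Fin k → ℕ) (i : Fin k) (j : Fin (n i)) : Fin (∑ i, n i) :=
  finSigmaFinEquiv ⟨i, j⟩

/-- The subgroup `S_{n₁} × ⋯ × S_{n_k}` of `S_{n₁ + ⋯ + n_k}`: the permutations that map each
block of consecutive elements to itself. -/
def youngSubgroup (n : Fin k → ℕ) : Subgroup (Equiv.Perm (Fin (∑ i, n i))) where
  carrier := {σ | ∀ j, (finSigmaFinEquiv.symm (σ j)).1 = (finSigmaFinEquiv.symm j).1}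
  one_mem' := fun _ => rfl
  mul_mem' := fun {σ τ} hσ hτ j => (hσ (τ j)).trans (hτ j)
  inv_mem' := fun {σ} hσ j => by
    have := hσ (σ⁻¹ j)
    rw [show σ (σ⁻¹ j) = j from Equiv.apply_symm_apply σ j] at this
    exact this.symm

end Young

section Monogenic

variable {R : Type*} [CommRing R] {k : ℕ}

/-- The factorizations `f = f₁ ⋯ f_k` into monic factors of degrees `n₁, …, n_k`. -/
structure MonicFactorization (f : R[X]) (n : Fin k → ℕ) where
  factor : Fin k → R[X]
  monic : ∀ i, (factor i).Monic
  natDegree_eq : ∀ i, (factor i).natDegree = n i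
  prod_eq : ∏ i, factor i = f

theorem isFreeOfRank_adjoinRoot {f : R[X]} (hf : f.Monic) {n : ℕ} (hn : f.natDegree = n) :
    IsFreeOfRank R (AdjoinRoot f) n :=
  ⟨(AdjoinRoot.powerBasisAux' hf).reindex (finCongr hn)⟩

/-- For a factor `f_i` of `f`, the projection `R[x]/(f) → R[x]/(f_i)`, `x ↦ x`. -/
noncomputable def MonicFactorization.proj {f : R[X]} {n : Fin k → ℕ}
    (F : MonicFactorization f n) (i : Fin k) : AdjoinRoot f →ₐ[R] AdjoinRoot (F.factor i) :=
  AdjoinRoot.algHomOfDvd R f (F.factor i)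
    ((Finset.dvd_prod_of_mem F.factor (Finset.mem_univ i)).trans (dvd_of_eq F.prod_eq))

/-- The Ferrand homomorphism of `A_i = R[x]/(f_i)`. -/
noncomputable def MonicFactorization.ferrandFactor {f : R[X]} {n : Fin k → ℕ}
    (F : MonicFactorization f n) (i : Fin k) :
    invariants R (AdjoinRoot (F.factor i)) (⊤ : Subgroup (Equiv.Perm (Fin (n i)))) →ₐ[R] R :=
  ferrand (isFreeOfRank_adjoinRoot (F.monic i) (F.natDegree_eq i))

/-- The homomorphism `φ : (A^{⊗n})^{S_{n₁} × ⋯ × S_{n_k}} → R`, where `A = R[x]/(f)`, is the one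
attached to the factorization `f = f₁ ⋯ f_k`, i.e. the composite
`(A^{⊗n})^{∏ S_{n_i}} ≅ ⨂_i (A^{⊗n_i})^{S_{n_i}} → ⨂_i (A_i^{⊗n_i})^{S_{n_i}} → R`
whose last arrow is the product of the Ferrand homomorphisms of the `A_i = R[x]/(f_i)`:
for symmetric `α_i ∈ A^{⊗n_i}`, it sends `α₁ ⊗ ⋯ ⊗ α_k ∈ A^{⊗n}` to the product of the Ferrand
homomorphisms at the images of the `α_i`. -/
def MonicFactorization.IsAttached {f : R[X]} {n : Fin k → ℕ} (F : MonicFactorization f n)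
    (φ : invariants R (AdjoinRoot f) (youngSubgroup n) →ₐ[R] R) : Prop :=
  ∀ α : (i : Fin k) → invariants R (AdjoinRoot f) (⊤ : Subgroup (Equiv.Perm (Fin (n i)))),
    ∃ h : ∏ i, tensorMap (AlgHom.id R (AdjoinRoot f)) (blockPos n i)
        (α i : ⨂[R] _ : Fin (n i), AdjoinRoot f) ∈
          invariants R (AdjoinRoot f) (youngSubgroup n),
      φ ⟨_, h⟩ = ∏ i, F.ferrandFactor i (mapInvariants (F.proj i) ⊤ (α i))

/-- The polynomial `p(λ)` is the coefficientwise image under `φ` of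
`1 ⊗ ⋯ ⊗ 1 ⊗ (λ - x)^{⊗n_i} ⊗ 1 ⊗ ⋯ ⊗ 1`, the product of the `λ - x^{(j)}` over the positions `j`
of the `i`-th block, a polynomial with invariant coefficients. -/
def IsBlockPolynomial {f : R[X]} {n : Fin k → ℕ}
    (φ : invariants R (AdjoinRoot f) (youngSubgroup n) →ₐ[R] R) (i : Fin k) (p : R[X]) : Prop :=
  ∃ P : (invariants R (AdjoinRoot f) (youngSubgroup n))[X],
    P.map (invariants R (AdjoinRoot f) (youngSubgroup n)).val.toRingHom =
      ∏ j : Fin (n i), (X - C (PiTensorProduct.singleAlgHom (R := R)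
        (A := fun _ : Fin (∑ i, n i) => AdjoinRoot f) (blockPos n i j) (AdjoinRoot.root f))) ∧
    P.map φ.toRingHom = p

end Monogenic

end ClosureData

open ClosureData

/-!
Let `x` be the class of the variable in `A = R[x]/(f)`. The monomials in the `x^{(j)}` form a basis
of `A^{⊗n}` that is permuted by `S_n`, so an invariant of `G = S_{n₁} × ⋯ × S_{n_k}` is a linear
combination of orbit sums of monomials. Such an orbit sum is a product over the blocks of orbit
sums in the variables of one block, and the fundamental theorem on symmetric polynomials expresses
it through the coefficients of the block polynomials `∏ (λ - x^{(j)})`, `j` in the `i`-th block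
(`mem_adjoin_blockPoly`). Hence two homomorphisms from the invariants agree once they agree on the
block polynomials (`invariants_algHom_ext`, and `symmetric_algHom_ext` for a single block), and
every identity between homomorphisms below is checked there.

The Ferrand homomorphism sends `∏ (λ - x^{(j)})`, over all `j`, to the characteristic polynomial
`f` of `x` (`map_ferrand_symPoly`, `charpoly_lmul_root`). So a closure datum sends the block
polynomials to monic `f_i` with product `f`, and it is determined by them. Conversely, given
`f = f₁ ⋯ f_k`, adjoin roots of the `f_i` one at a time to get a faithful `R`-algebra `S` in which
every `f_i` splits. Evaluating the `x^{(j)}` of the `i`-th block at the roots of `f_i` is a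
homomorphism `A^{⊗n} → S` that sends the coefficients of the block polynomials to those of the
`f_i`. It therefore maps the invariants to `R` (`MonicFactorization.exists_algHom`), and it extends
the Ferrand homomorphism because both send `∏ (λ - x^{(j)})` to `f`.

The closure algebra `A^{⊗n}/φ` classifies the homomorphisms from `A^{⊗n}` that restrict to `φ` on
the invariants, that is, the families of elements `x^{(j)}` with `∏ (λ - x^{(j)}) = f_i` over the
`i`-th block, for all `i`. The tensor product of the `A_i^{⊗n_i}/Ferrand` classifies the same
families, and `closureAlgebraEquiv` compares the two.
-/

universe u

namespace ClosureData

/-! ### Symmetric sums of monomials -/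

/-- The sum of the monomials `X₁^{q₁} ⋯ X_n^{q_n}` over all rearrangements `q` of a fixed tuple of
exponents, recorded by its sorted rearrangement `s`. -/
noncomputable def orbitSum (R : Type*) [CommRing R] {n d : ℕ} (s : Fin n → Fin d) :
    MvPolynomial (Fin n) R :=
  ∑ q : Fin n → Fin d with q ∘ Tuple.sort q = s, ∏ j, MvPolynomial.X j ^ (q j : ℕ)

theorem orbitSum_isSymmetric (R : Type*) [CommRing R] {n d : ℕ} (s : Fin n → Fin d) :
    (orbitSum R s).IsSymmetric := by
  intro σ
  simp only [orbitSum, map_sum, map_prod, map_pow, MvPolynomial.rename_X]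
  refine Finset.sum_bij' (fun q _ => q ∘ σ.symm) (fun q _ => q ∘ σ) ?_ ?_ ?_ ?_ ?_
  · intro q hq
    simp only [Finset.mem_filter, Finset.mem_univ, true_and] at hq ⊢
    rw [Tuple.comp_perm_comp_sort_eq_comp_sort, hq]
  · intro q hq
    simp only [Finset.mem_filter, Finset.mem_univ, true_and] at hq ⊢
    rw [Tuple.comp_perm_comp_sort_eq_comp_sort, hq]
  · intro q _
    funext j
    simp
  · intro q _
    funext j
    simp
  · intro q _
    exact Fintype.prod_equiv σ _ _ fun j => by simp

/-- The fundamental theorem on symmetric polynomials, evaluated at a tuple `y`: the values of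
symmetric polynomials are polynomials in the coefficients of `∏ (X - y_j)`. -/
theorem aeval_mem_adjoin_coeff {R B : Type*} [CommRing R] [CommRing B] [Algebra R B] {n : ℕ}
    {p : MvPolynomial (Fin n) R} (hp : p.IsSymmetric) (y : Fin n → B) :
    MvPolynomial.aeval y p ∈
      Algebra.adjoin R (Set.range fun m => (∏ j, (X - C (y j))).coeff m) := by
  obtain ⟨Q, hQ⟩ := MvPolynomial.esymmAlgHom_surjective (σ := Fin n) R (n := n) (by simp) ⟨p, hp⟩
  have hQ' : p = MvPolynomial.aeval (fun i : Fin n => MvPolynomial.esymm (Fin n) R (i + 1)) Q := by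
    rw [← MvPolynomial.esymmAlgHom_apply, hQ]
  rw [hQ', ← AlgHom.comp_apply, MvPolynomial.comp_aeval]
  have hmem : MvPolynomial.aeval (fun i : Fin n =>
      MvPolynomial.aeval y (MvPolynomial.esymm (Fin n) R (i + 1))) Q ∈
      Algebra.adjoin R (Set.range fun i : Fin n =>
        MvPolynomial.aeval y (MvPolynomial.esymm (Fin n) R (i + 1))) := by
    rw [Algebra.adjoin_range_eq_range_aeval]
    exact ⟨Q, rfl⟩
  refine Algebra.adjoin_le ?_ hmem
  rintro _ ⟨i, rfl⟩
  have hc := Multiset.prod_X_sub_C_coeff ((Finset.univ : Finset (Fin n)).val.map y)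
    (k := n - (i + 1)) (by simp)
  have hi : n - (n - (i + 1 : ℕ)) = i + 1 := by omega
  rw [Multiset.map_map] at hc
  simp only [Multiset.card_map, Finset.card_val, Finset.card_univ, Fintype.card_fin, hi] at hc
  change (∏ j, (X - C (y j))).coeff (n - (i + 1)) = _ at hc
  have hmul : MvPolynomial.aeval y (MvPolynomial.esymm (Fin n) R (i + 1)) =
      (-1) ^ (i + 1 : ℕ) * (∏ j, (X - C (y j))).coeff (n - (i + 1)) := by
    rw [hc, ← mul_assoc, ← mul_pow, MvPolynomial.aeval_esymm_eq_multiset_esymm]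
    simp
  simp only [SetLike.mem_coe]
  rw [hmul]
  exact mul_mem (pow_mem (neg_mem (one_mem _)) _) (Algebra.subset_adjoin ⟨_, rfl⟩)

/-! ### Generators of the invariants of a Young subgroup -/

section Invariants

variable {R A B : Type*} [CommRing R] [CommRing A] [Algebra R A] [CommRing B] [Algebra R B]

/-- The polynomial `∏ (λ - x^{(j)})` over the positions `j` of the block `i`. The blocks are given
by a bijection `e` from the disjoint union of the `Fin (m i)` to the set of all positions. -/
noncomputable def blockPoly (R : Type*) [CommRing R] [Algebra R A] {κ : Type*} {m : κ → ℕ} {N : ℕ}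
    (e : (Σ i, Fin (m i)) ≃ Fin N) (x : A) (i : κ) : (⨂[R] _ : Fin N, A)[X] :=
  ∏ j : Fin (m i), (X - C (PiTensorProduct.singleAlgHom (R := R) (A := fun _ : Fin N => A)
    (e ⟨i, j⟩) x))

theorem repr_tensorMap_perm {N : ℕ} {ι : Type*} [Fintype ι] [DecidableEq ι]
    (b : Module.Basis ι R A) (σ : Equiv.Perm (Fin N)) (α : ⨂[R] _ : Fin N, A) (p : Fin N → ι) :
    (Basis.piTensorProduct (R := R) (fun _ : Fin N => b)).repr
        (tensorMap (AlgHom.id R A) σ α) p =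
      (Basis.piTensorProduct (R := R) (fun _ : Fin N => b)).repr α (p ∘ σ) := by
  set c := Basis.piTensorProduct (R := R) (fun _ : Fin N => b) with hc
  have h : (c.coord p).comp (tensorMap (AlgHom.id R A) (σ : Fin N → Fin N)).toLinearMap =
      c.coord (p ∘ σ) := by
    refine PiTensorProduct.ext (MultilinearMap.ext fun w => ?_)
    simp only [LinearMap.compMultilinearMap_apply, LinearMap.comp_apply,
      AlgHom.toLinearMap_apply, tensorMap_perm_tprod, Module.Basis.coord_apply, hc,
      Basis.piTensorProduct_repr_tprod_apply]
    exact (Fintype.prod_equiv σ _ _ (fun k => by simp)).symm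
  exact DFunLike.congr_fun h α

/-- Let `A` be generated by `x`, with a basis of powers of `x`. Grouping the monomials in the
`x^{(j)}` by orbits of the group of block-preserving permutations writes an invariant tensor as a
linear combination of products over the blocks of symmetric polynomials in the `x^{(j)}` of the
block, so it is a polynomial in the coefficients of the `∏ (λ - x^{(j)})`. -/
theorem mem_adjoin_blockPoly {κ : Type*} [Fintype κ] [DecidableEq κ] {m : κ → ℕ} {N : ℕ}
    (e : (Σ i, Fin (m i)) ≃ Fin N) (pb : PowerBasis R A) {α : ⨂[R] _ : Fin N, A}
    (hα : ∀ σ : Equiv.Perm (Fin N), (∀ j, (e.symm (σ j)).1 = (e.symm j).1) →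
      tensorMap (AlgHom.id R A) σ α = α) :
    α ∈ Algebra.adjoin R (⋃ i, Set.range (blockPoly R e pb.gen i).coeff) := by
  classical
  set c := Basis.piTensorProduct (R := R) (fun _ : Fin N => pb.basis) with hc
  -- exponent tuples on all positions, read off block by block
  let E : ((i : κ) → Fin (m i) → Fin pb.dim) ≃ (Fin N → Fin pb.dim) :=
    (Equiv.piCurry (fun (i : κ) (_ : Fin (m i)) => Fin pb.dim)).symm.trans
      (Equiv.arrowCongr e (Equiv.refl _))
  have hE : ∀ p i j, E p (e ⟨i, j⟩) = p i j := by
    intro p i j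
    change Sigma.uncurry p (e.symm (e ⟨i, j⟩)) = p i j
    rw [Equiv.symm_apply_apply]
    rfl
  -- the representative of the orbit of an exponent tuple that is sorted on every block
  let S : ((i : κ) → Fin (m i) → Fin pb.dim) → (i : κ) → Fin (m i) → Fin pb.dim :=
    fun p i => p i ∘ Tuple.sort (p i)
  have hS : ∀ p, c.repr α (E p) = c.repr α (E (S p)) := by
    intro p
    let σ : Equiv.Perm (Fin N) :=
      e.symm.trans ((Equiv.sigmaCongrRight fun i => Tuple.sort (p i)).trans e)
    have h1 := repr_tensorMap_perm pb.basis σ α (E p)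
    rw [hα σ (fun j => by simp [σ])] at h1
    rw [← hc] at h1
    rw [h1]
    congr 1
    funext l
    obtain ⟨⟨i, j⟩, rfl⟩ := e.surjective l
    rw [hE]
    simp [σ, hE, S]
  have hmon : ∀ p, c (E p) = ∏ i, ∏ j, (PiTensorProduct.singleAlgHom (R := R)
      (A := fun _ : Fin N => A) (e ⟨i, j⟩) pb.gen) ^ (p i j : ℕ) := by
    intro p
    rw [hc, Basis.piTensorProduct_apply, tprod_eq_prod, ← e.prod_comp, Fintype.prod_sigma]
    simp [hE, pb.basis_eq_pow, -PiTensorProduct.singleAlgHom_apply]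
  have hα' : α = ∑ s, c.repr α (E s) • ∏ i, MvPolynomial.aeval (fun j =>
      PiTensorProduct.singleAlgHom (R := R) (A := fun _ : Fin N => A) (e ⟨i, j⟩) pb.gen)
        (orbitSum R (s i)) := by
    conv_lhs => rw [← c.sum_repr α, ← E.sum_comp, ← Finset.sum_fiberwise _ S]
    refine Finset.sum_congr rfl fun s _ => ?_
    simp only [orbitSum, map_sum, map_prod, map_pow, MvPolynomial.aeval_X]
    rw [Finset.prod_univ_sum, Finset.smul_sum]
    refine Finset.sum_congr ?_ ?_
    · ext p
      simp [S, funext_iff (f := fun i => p i ∘ Tuple.sort (p i)), Fintype.mem_piFinset]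
    · intro p hp
      rw [hmon, hS]
      have hp' : S p = s := funext fun i => by simpa using Fintype.mem_piFinset.1 hp i
      rw [hp']
  rw [hα']
  refine Subalgebra.sum_mem _ fun s _ =>
    Subalgebra.smul_mem _ (Subalgebra.prod_mem _ fun i _ => ?_) _
  refine Algebra.adjoin_mono (Set.subset_iUnion_of_subset i ?_)
    (aeval_mem_adjoin_coeff (orbitSum_isSymmetric R (s i)) _)
  exact subset_rfl

theorem map_blockPoly {κ : Type*} {m : κ → ℕ} {N : ℕ} (e : (Σ i, Fin (m i)) ≃ Fin N) (x : A)
    (i : κ) (χ : (⨂[R] _ : Fin N, A) →ₐ[R] B) :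
    (blockPoly R e x i).map χ.toRingHom = ∏ j, (X - C (χ (PiTensorProduct.singleAlgHom (R := R)
      (A := fun _ : Fin N => A) (e ⟨i, j⟩) x))) := by
  simp [blockPoly, Polynomial.map_prod, -PiTensorProduct.singleAlgHom_apply]

theorem prod_blockPoly {κ : Type*} [Fintype κ] {m : κ → ℕ} {N : ℕ}
    (e : (Σ i, Fin (m i)) ≃ Fin N) (x : A) :
    ∏ i, blockPoly R e x i = ∏ l, (X - C (PiTensorProduct.singleAlgHom (R := R)
      (A := fun _ : Fin N => A) l x)) := by
  rw [← e.prod_comp, Fintype.prod_sigma]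
  rfl

theorem map_inclusion_map_val {S T : Subalgebra R A} (h : S ≤ T) (P : S[X]) :
    (P.map (Subalgebra.inclusion h).toRingHom).map T.val.toRingHom =
      P.map S.val.toRingHom := by
  rw [Polynomial.map_map]
  rfl

theorem prod_block {M κ : Type*} [CommMonoid M] {m : κ → ℕ} [Fintype κ] [DecidableEq κ] {N : ℕ}
    (e : (Σ i, Fin (m i)) ≃ Fin N) (g : Fin N → M) (i : κ) :
    ∏ j, g (e ⟨i, j⟩) = ∏ l, if (e.symm l).1 = i then g l else 1 := by
  rw [← e.prod_comp, Fintype.prod_sigma, Finset.prod_eq_single i]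
  · simp
  · intro i' _ hi'
    simp [hi']
  · simp

variable {κ : Type*} [Fintype κ] [DecidableEq κ] {m : κ → ℕ} {N : ℕ}
  (e : (Σ i, Fin (m i)) ≃ Fin N) {G : Subgroup (Equiv.Perm (Fin N))}

theorem exists_map_val_eq_blockPoly
    (hG : ∀ σ, σ ∈ G ↔ ∀ j, (e.symm (σ j)).1 = (e.symm j).1) (x : A) (i : κ) :
    ∃ P : (invariants R A G)[X],
      P.map (invariants R A G).val.toRingHom = blockPoly R e x i := by
  have h : blockPoly R e x i ∈ lifts (invariants R A G).val.toRingHom := by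
    rw [lifts_iff_coeff_lifts]
    intro l
    suffices (blockPoly R e x i).coeff l ∈ invariants R A G from ⟨⟨_, this⟩, rfl⟩
    refine mem_invariants.2 fun σ hσ => ?_
    have hmap : (blockPoly R e x i).map
        (tensorMap (R := R) (AlgHom.id R A) (σ : Fin N → Fin N)).toRingHom =
        blockPoly R e x i := by
      rw [map_blockPoly, blockPoly]
      simp only [tensorMap_single, AlgHom.id_apply]
      rw [prod_block e (fun l => X - C (PiTensorProduct.singleAlgHom (R := R)
          (A := fun _ : Fin N => A) (σ l) x)),
        prod_block e (fun l => X - C (PiTensorProduct.singleAlgHom (R := R)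
          (A := fun _ : Fin N => A) l x))]
      exact Fintype.prod_equiv σ _ _ fun l => by rw [(hG σ).1 hσ l]
    conv_rhs => rw [← hmap]
    simp
  exact (lifts_iff_set_range _).1 h

/-- The polynomial `∏ (λ - x^{(j)})` over the positions `j` of the block `i`, as a polynomial over
the invariants of the group `G` of all permutations that preserve the blocks. -/
noncomputable def invBlockPoly (hG : ∀ σ, σ ∈ G ↔ ∀ j, (e.symm (σ j)).1 = (e.symm j).1) (x : A)
    (i : κ) : (invariants R A G)[X] :=
  Classical.choose (exists_map_val_eq_blockPoly e hG x i)

variable (hG : ∀ σ, σ ∈ G ↔ ∀ j, (e.symm (σ j)).1 = (e.symm j).1)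

theorem map_val_invBlockPoly (x : A) (i : κ) :
    (invBlockPoly (R := R) e hG x i).map (invariants R A G).val.toRingHom = blockPoly R e x i :=
  Classical.choose_spec (exists_map_val_eq_blockPoly e hG x i)

theorem map_val_injective : Function.Injective
    (Polynomial.map (invariants R A G).val.toRingHom) :=
  Polynomial.map_injective _ Subtype.val_injective

theorem invBlockPoly_monic (x : A) (i : κ) : (invBlockPoly (R := R) e hG x i).Monic := by
  refine Polynomial.monic_of_injective (f := (invariants R A G).val.toRingHom)
    Subtype.val_injective ?_
  rw [map_val_invBlockPoly]
  exact monic_prod_X_sub_C _ _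

theorem natDegree_map_invBlockPoly [Nontrivial B] (x : A) (i : κ)
    (φ : invariants R A G →ₐ[R] B) :
    ((invBlockPoly (R := R) e hG x i).map φ.toRingHom).natDegree = m i := by
  have : Nontrivial (invariants R A G) := φ.toRingHom.domain_nontrivial
  have : Nontrivial (⨂[R] _ : Fin N, A) :=
    Function.Injective.nontrivial (Subtype.val_injective (p := (· ∈ invariants R A G)))
  rw [(invBlockPoly_monic e hG x i).natDegree_map, ← natDegree_map_eq_of_injective
    (f := (invariants R A G).val.toRingHom) Subtype.val_injective, map_val_invBlockPoly, blockPoly,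
    natDegree_finsetProd_X_sub_C_eq_card, Finset.card_univ, Fintype.card_fin]

/-- A subalgebra of the invariants is everything as soon as it contains the elementary symmetric
polynomials in the conjugates `x^{(j)}` of the generator over every block. -/
theorem eq_top_of_coeff_invBlockPoly_mem (pb : PowerBasis R A)
    (T : Subalgebra R (invariants R A G))
    (hT : ∀ i l, (invBlockPoly e hG pb.gen i).coeff l ∈ T) : T = ⊤ := by
  refine eq_top_iff.2 fun α _ => ?_
  have h := mem_adjoin_blockPoly e pb (α := α)
    fun σ hσ => mem_invariants.1 α.2 σ ((hG σ).2 hσ)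
  have hle : Algebra.adjoin R (⋃ i, Set.range (blockPoly R e pb.gen i).coeff) ≤
      T.map (invariants R A G).val := by
    refine Algebra.adjoin_le (Set.iUnion_subset fun i => ?_)
    rintro _ ⟨l, rfl⟩
    refine ⟨_, hT i l, ?_⟩
    rw [← map_val_invBlockPoly e hG, coeff_map]
    rfl
  obtain ⟨β, hβ, hβα⟩ := hle h
  rwa [← Subtype.ext hβα]

theorem invariants_algHom_ext (pb : PowerBasis R A) {φ ψ : invariants R A G →ₐ[R] B}
    (h : ∀ i, (invBlockPoly e hG pb.gen i).map φ.toRingHom =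
      (invBlockPoly e hG pb.gen i).map ψ.toRingHom) : φ = ψ := by
  have : AlgHom.equalizer φ ψ = ⊤ := by
    refine eq_top_of_coeff_invBlockPoly_mem e hG pb _ fun i l => ?_
    simpa using congrArg (fun p => coeff p l) (h i)
  ext α
  exact (this ▸ Algebra.mem_top : α ∈ AlgHom.equalizer φ ψ)

end Invariants

/-! ### The full symmetric group and the Ferrand homomorphism -/

section Symmetric

variable {R A B : Type*} [CommRing R] [CommRing A] [Algebra R A] [CommRing B] [Algebra R B]

/-- The set of all `n` positions as a single block. -/
def singleBlock (n : ℕ) : (Σ _ : Unit, Fin n) ≃ Fin n := Equiv.uniqueSigma _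

theorem mem_top_iff_preserves_singleBlock (n : ℕ) (σ : Equiv.Perm (Fin n)) :
    σ ∈ (⊤ : Subgroup (Equiv.Perm (Fin n))) ↔
      ∀ j, ((singleBlock n).symm (σ j)).1 = ((singleBlock n).symm j).1 := by
  simp

/-- The polynomial `∏ (λ - x^{(j)})` over all positions `j`, with symmetric coefficients. -/
noncomputable def symPoly (R : Type*) [CommRing R] [Algebra R A] (n : ℕ) (x : A) :
    (invariants R A (⊤ : Subgroup (Equiv.Perm (Fin n))))[X] :=
  invBlockPoly (singleBlock n) (mem_top_iff_preserves_singleBlock n) x ()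

theorem map_val_symPoly (n : ℕ) (x : A) :
    (symPoly R n x).map (invariants R A (⊤ : Subgroup (Equiv.Perm (Fin n)))).val.toRingHom =
      ∏ j, (X - C (PiTensorProduct.singleAlgHom (R := R) (A := fun _ : Fin n => A) j x)) :=
  map_val_invBlockPoly _ _ _ _

theorem symmetric_algHom_ext (pb : PowerBasis R A) {n : ℕ}
    {φ ψ : invariants R A (⊤ : Subgroup (Equiv.Perm (Fin n))) →ₐ[R] B}
    (h : (symPoly R n pb.gen).map φ.toRingHom = (symPoly R n pb.gen).map ψ.toRingHom) : φ = ψ :=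
  invariants_algHom_ext (singleBlock n) (mem_top_iff_preserves_singleBlock n) pb fun _ => h

theorem map_comp_val_symPoly (n : ℕ) (x : A) (χ : (⨂[R] _ : Fin n, A) →ₐ[R] B) :
    (symPoly R n x).map
      (χ.comp (invariants R A (⊤ : Subgroup (Equiv.Perm (Fin n)))).val).toRingHom =
      ∏ j, (X - C (χ (PiTensorProduct.singleAlgHom (R := R) (A := fun _ : Fin n => A) j x))) := by
  have h := congrArg (Polynomial.map χ.toRingHom) (map_val_symPoly (R := R) n x)
  rw [Polynomial.map_map] at h
  refine h.trans ?_
  simp [Polynomial.map_prod, -PiTensorProduct.singleAlgHom_apply]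

/-- The Ferrand homomorphism sends `∏ (λ - x^{(j)})` to the characteristic polynomial of `x`. -/
theorem map_ferrand_symPoly [Module.Free R A] [Module.Finite R A] {n : ℕ}
    (h : IsFreeOfRank R A n) (x : A) :
    (symPoly R n x).map (ferrand h).toRingHom = (Algebra.lmul R A x).charpoly := by
  nontriviality R
  have hcard : Module.finrank R A = n := by
    obtain ⟨b⟩ := h
    simpa using Module.finrank_eq_card_basis b
  have hdeg : ((symPoly R n x).map (ferrand h).toRingHom).natDegree = n :=
    natDegree_map_invBlockPoly _ _ _ _ _
  ext l
  rcases le_or_gt l n with hl | hl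
  · have hval : ((-1) ^ (n - l) * (symPoly R n x).coeff l : invariants R A ⊤).1 =
        ∑ s ∈ Finset.powersetCard (n - l) (Finset.univ : Finset (Fin n)), ∏ i ∈ s,
          PiTensorProduct.singleAlgHom (R := R) (A := fun _ : Fin n => A) i x := by
      have hc := Multiset.prod_X_sub_C_coeff ((Finset.univ : Finset (Fin n)).val.map fun i =>
        PiTensorProduct.singleAlgHom (R := R) (A := fun _ : Fin n => A) i x) (k := l) (by simpa)
      rw [Multiset.map_map] at hc
      simp only [Multiset.card_map, Finset.card_val, Finset.card_univ, Fintype.card_fin] at hc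
      change (∏ j, (X - C (PiTensorProduct.singleAlgHom (R := R)
        (A := fun _ : Fin n => A) j x))).coeff l = _ at hc
      rw [← map_val_symPoly, coeff_map, Finset.esymm_map_val] at hc
      have hc' : ((symPoly R n x).coeff l).1 = _ := hc
      simp only [MulMemClass.coe_mul, SubmonoidClass.coe_pow, NegMemClass.coe_neg,
        OneMemClass.coe_one, hc', ← mul_assoc, ← mul_pow]
      simp
    have ha := ((-1) ^ (n - l) * (symPoly R n x).coeff l : invariants R A ⊤).2
    rw [hval] at ha
    have hf := ferrand_esymm h x (Nat.sub_le n l) ha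
    rw [show (⟨_, ha⟩ : invariants R A ⊤) = (-1) ^ (n - l) * (symPoly R n x).coeff l from
      Subtype.ext hval.symm, map_mul, map_pow, map_neg, map_one, Nat.sub_sub_self hl] at hf
    rw [coeff_map]
    -- cancel the sign
    have := congrArg (fun y => (-1 : R) ^ (n - l) * y) hf
    simpa [← mul_assoc, ← mul_pow] using this
  · rw [coeff_eq_zero_of_natDegree_lt (hdeg.trans_lt hl), coeff_eq_zero_of_natDegree_lt]
    rwa [LinearMap.charpoly_natDegree, hcard]

/-- By the Cayley-Hamilton theorem the characteristic polynomial of the class of `x` is a multiple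
of `f`, and both are monic of the same degree. -/
theorem charpoly_lmul_root {f : R[X]} (hf : f.Monic) [Module.Free R (AdjoinRoot f)]
    [Module.Finite R (AdjoinRoot f)] :
    (Algebra.lmul R (AdjoinRoot f) (AdjoinRoot.root f)).charpoly = f := by
  nontriviality R
  have hd : f ∣ (Algebra.lmul R (AdjoinRoot f) (AdjoinRoot.root f)).charpoly := by
    rw [← AdjoinRoot.mk_eq_zero]
    have := LinearMap.aeval_self_charpoly (Algebra.lmul R (AdjoinRoot f) (AdjoinRoot.root f))
    rw [Polynomial.aeval_algHom_apply] at this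
    rw [← AdjoinRoot.aeval_eq]
    exact Algebra.lmul_injective (this.trans (map_zero _).symm)
  refine (Polynomial.eq_of_monic_of_dvd_of_natDegree_le hf (LinearMap.charpoly_monic _) hd
    ?_)
  rw [LinearMap.charpoly_natDegree, (AdjoinRoot.powerBasis' hf).finrank,
    AdjoinRoot.powerBasis'_dim]

end Symmetric

/-! ### Homomorphisms out of tensor products of algebras -/

section LiftFamily

variable {R ι S : Type*} [CommRing R] [Fintype ι] {A : ι → Type*}
  [∀ i, CommRing (A i)] [∀ i, Algebra R (A i)] [CommRing S] [Algebra R S]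

/-- The homomorphism `⨂ A_i → S` with components `g i : A_i → S`: the tensor product is the
coproduct of commutative algebras. -/
noncomputable def liftFamily (g : ∀ i, A i →ₐ[R] S) : (⨂[R] i, A i) →ₐ[R] S :=
  PiTensorProduct.liftAlgHom
    ((MultilinearMap.mkPiAlgebra R ι S).compLinearMap fun i => (g i).toLinearMap)
    (by simp [MultilinearMap.mkPiAlgebra_apply])
    (fun x y => by simp [MultilinearMap.mkPiAlgebra_apply, Finset.prod_mul_distrib])

theorem liftFamily_tprod (g : ∀ i, A i →ₐ[R] S) (v : ∀ i, A i) :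
    liftFamily g (PiTensorProduct.tprod R v) = ∏ i, g i (v i) := by
  refine (PiTensorProduct.lift.tprod v).trans ?_
  simp [MultilinearMap.mkPiAlgebra_apply]

theorem liftFamily_single [DecidableEq ι] (g : ∀ i, A i →ₐ[R] S) (i : ι) (a : A i) :
    liftFamily g (PiTensorProduct.singleAlgHom (R := R) (A := A) i a) = g i a := by
  rw [PiTensorProduct.singleAlgHom_apply, liftFamily_tprod]
  simp only [MonoidHom.mulSingle_apply]
  rw [Finset.prod_eq_single i]
  · simp
  · intro j _ hj
    rw [Pi.mulSingle_eq_of_ne hj, map_one]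
  · simp

end LiftFamily

/-! ### Splitting monic polynomials in a faithful extension -/

/-- Adjoining a root of a monic polynomial is an injective extension, so a monic polynomial splits
in a suitable faithful algebra. -/
theorem exists_faithful_splitting {d : ℕ} {R : Type u} [CommRing R] {f : R[X]}
    (hf : f.Monic) (hd : f.natDegree = d) :
    ∃ (S : Type u) (_ : CommRing S) (_ : Algebra R S) (r : Fin d → S),
      Function.Injective (algebraMap R S) ∧ f.map (algebraMap R S) = ∏ j, (X - C (r j)) := by
  induction d generalizing R with
  | zero =>
    refine ⟨R, inferInstance, inferInstance, Fin.elim0, fun _ _ h => h, ?_⟩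
    simp [hf.natDegree_eq_zero.1 hd]
  | succ d ih =>
    have : Nontrivial R := by
      by_contra hR
      rw [not_nontrivial_iff_subsingleton] at hR
      rw [Subsingleton.elim f 0, natDegree_zero] at hd
      omega
    let S₁ := AdjoinRoot f
    have hinj : Function.Injective (algebraMap R S₁) :=
      (injective_iff_map_eq_zero _).2 fun a ha => by
        by_contra h0
        refine hf.not_dvd_of_natDegree_lt (C_ne_zero.2 h0) ?_ (AdjoinRoot.mk_eq_zero.1 ha)
        rw [natDegree_C, hd]
        exact d.succ_pos
    have hmonic := hf.map (algebraMap R S₁)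
    have hroot : (f.map (algebraMap R S₁)).IsRoot (AdjoinRoot.root f) := AdjoinRoot.isRoot_root f
    obtain ⟨g, hg⟩ := dvd_iff_isRoot.2 hroot
    have hgm : g.Monic := (monic_X_sub_C _).of_mul_monic_left (hg ▸ hmonic)
    have : Nontrivial S₁ := hinj.nontrivial
    have hgd : g.natDegree = d := by
      have h := (monic_X_sub_C (AdjoinRoot.root f)).natDegree_mul hgm
      rw [← hg, hf.natDegree_map, hd, natDegree_X_sub_C] at h
      omega
    obtain ⟨S, _, _, r, hS, hr⟩ := ih hgm hgd
    let _ : Algebra R S := ((algebraMap S₁ S).comp (algebraMap R S₁)).toAlgebra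
    refine ⟨S, inferInstance, inferInstance,
      Fin.cons (algebraMap S₁ S (AdjoinRoot.root f)) r, hS.comp hinj, ?_⟩
    rw [RingHom.algebraMap_toAlgebra, ← Polynomial.map_map, hg, Polynomial.map_mul, hr,
      Fin.prod_univ_succ]
    simp

theorem exists_faithful_splitting_family {k : ℕ} {R : Type u} [CommRing R] {n : Fin k → ℕ}
    (F : Fin k → R[X]) (hF : ∀ i, (F i).Monic) (hn : ∀ i, (F i).natDegree = n i) :
    ∃ (S : Type u) (_ : CommRing S) (_ : Algebra R S) (r : ∀ i, Fin (n i) → S),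
      Function.Injective (algebraMap R S) ∧
        ∀ i, (F i).map (algebraMap R S) = ∏ j, (X - C (r i j)) := by
  induction k with
  | zero =>
    exact ⟨R, inferInstance, inferInstance, fun i => i.elim0, fun _ _ h => h, fun i => i.elim0⟩
  | succ k ih =>
    obtain ⟨S₁, _, _, r₁, h₁, hr₁⟩ := ih (fun i => F i.succ) (fun i => hF _) (fun i => hn _)
    have hd : ((F 0).map (algebraMap R S₁)).natDegree = n 0 := by
      rw [natDegree_map_eq_of_injective h₁, hn]
    obtain ⟨S, _, _, r, hS, hr⟩ := exists_faithful_splitting ((hF 0).map (algebraMap R S₁)) hd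
    let _ : Algebra R S := ((algebraMap S₁ S).comp (algebraMap R S₁)).toAlgebra
    refine ⟨S, inferInstance, inferInstance,
      Fin.cons (α := fun i => Fin (n i) → S) r fun i j => algebraMap S₁ S (r₁ i j),
      hS.comp h₁, fun i => ?_⟩
    rw [RingHom.algebraMap_toAlgebra, ← Polynomial.map_map]
    refine Fin.cases ?_ (fun i => ?_) i
    · simpa using hr
    · rw [hr₁]
      simp [Polynomial.map_prod]

/-! ### Closure data and factorizations -/

section Monogenic

variable {R : Type*} [CommRing R] {f : R[X]} {k : ℕ} (n : Fin k → ℕ)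

theorem mem_youngSubgroup (σ : Equiv.Perm (Fin (∑ i, n i))) :
    σ ∈ youngSubgroup n ↔ ∀ j, (finSigmaFinEquiv.symm (σ j)).1 = (finSigmaFinEquiv.symm j).1 :=
  Iff.rfl

/-- The polynomial `∏ (λ - x^{(j)})` over the `i`-th block of consecutive positions, with
coefficients invariant under the Young subgroup. -/
noncomputable def youngPoly (f : R[X]) (n : Fin k → ℕ) (i : Fin k) :
    (invariants R (AdjoinRoot f) (youngSubgroup n))[X] :=
  invBlockPoly finSigmaFinEquiv (mem_youngSubgroup n) (AdjoinRoot.root f) i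

theorem map_val_youngPoly (i : Fin k) :
    (youngPoly f n i).map (invariants R (AdjoinRoot f) (youngSubgroup n)).val.toRingHom =
      ∏ j : Fin (n i), (X - C (PiTensorProduct.singleAlgHom (R := R)
        (A := fun _ : Fin (∑ i, n i) => AdjoinRoot f) (blockPos n i j) (AdjoinRoot.root f))) :=
  map_val_invBlockPoly _ _ _ _

theorem map_comp_val_youngPoly {B : Type*} [CommRing B] [Algebra R B] (i : Fin k)
    (χ : (⨂[R] _ : Fin (∑ i, n i), AdjoinRoot f) →ₐ[R] B) :
    (youngPoly f n i).map
      (χ.comp (invariants R (AdjoinRoot f) (youngSubgroup n)).val).toRingHom =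
      ∏ j : Fin (n i), (X - C (χ (PiTensorProduct.singleAlgHom (R := R)
        (A := fun _ : Fin (∑ i, n i) => AdjoinRoot f) (blockPos n i j) (AdjoinRoot.root f)))) := by
  have h := congrArg (Polynomial.map χ.toRingHom) (map_val_youngPoly (f := f) n i)
  rw [Polynomial.map_map] at h
  refine h.trans ?_
  simp [Polynomial.map_prod, -PiTensorProduct.singleAlgHom_apply]

variable {n}

theorem young_algHom_ext (hf : f.Monic) {B : Type*} [CommRing B] [Algebra R B]
    {φ ψ : invariants R (AdjoinRoot f) (youngSubgroup n) →ₐ[R] B}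
    (h : ∀ i, (youngPoly f n i).map φ.toRingHom = (youngPoly f n i).map ψ.toRingHom) : φ = ψ :=
  invariants_algHom_ext finSigmaFinEquiv (mem_youngSubgroup n) (AdjoinRoot.powerBasis' hf)
    fun i => by
      rw [AdjoinRoot.powerBasis'_gen]
      exact h i

theorem symmetric_adjoinRoot_algHom_ext (hf : f.Monic) {d : ℕ} {B : Type*} [CommRing B]
    [Algebra R B]
    {φ ψ : invariants R (AdjoinRoot f) (⊤ : Subgroup (Equiv.Perm (Fin d))) →ₐ[R] B}
    (h : (symPoly R d (AdjoinRoot.root f)).map φ.toRingHom =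
      (symPoly R d (AdjoinRoot.root f)).map ψ.toRingHom) : φ = ψ :=
  symmetric_algHom_ext (AdjoinRoot.powerBasis' hf) (by rwa [AdjoinRoot.powerBasis'_gen])

theorem map_ferrand_symPoly_root (hf : f.Monic) {d : ℕ} (h : IsFreeOfRank R (AdjoinRoot f) d) :
    (symPoly R d (AdjoinRoot.root f)).map (ferrand h).toRingHom = f := by
  have : Module.Free R (AdjoinRoot f) := hf.free_adjoinRoot
  have : Module.Finite R (AdjoinRoot f) := hf.finite_adjoinRoot
  rw [map_ferrand_symPoly, charpoly_lmul_root hf]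

variable (f n) in
theorem prod_youngPoly :
    ∏ i, youngPoly f n i = (symPoly R (∑ i, n i) (AdjoinRoot.root f)).map
      (Subalgebra.inclusion (invariants_anti (le_top : youngSubgroup n ≤ ⊤))).toRingHom := by
  apply map_val_injective
  rw [map_inclusion_map_val, map_val_symPoly, Polynomial.map_prod,
    ← prod_blockPoly finSigmaFinEquiv]
  exact Finset.prod_congr rfl fun i _ => map_val_youngPoly n i

theorem prod_map_youngPoly (φ : invariants R (AdjoinRoot f) (youngSubgroup n) →ₐ[R] R) :
    ∏ i, (youngPoly f n i).map φ.toRingHom = (symPoly R (∑ i, n i) (AdjoinRoot.root f)).map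
      (φ.comp (Subalgebra.inclusion
        (invariants_anti (le_top : youngSubgroup n ≤ ⊤)))).toRingHom := by
  rw [← Polynomial.map_prod, prod_youngPoly, Polynomial.map_map]
  exact congrArg (fun g => Polynomial.map g _) (RingHom.ext fun _ => rfl)

/-- The factorization of `f` into the images of the polynomials `∏ (λ - x^{(j)})` over the
blocks. -/
noncomputable def ClosureDatum.toFactorization (hf : f.Monic) (hn : f.natDegree = ∑ i, n i)
    (φ : ClosureDatum (isFreeOfRank_adjoinRoot hf hn) (youngSubgroup n)) :
    MonicFactorization f n where
  factor i := (youngPoly f n i).map φ.toAlgHom.toRingHom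
  monic i := (invBlockPoly_monic _ _ _ _).map _
  natDegree_eq i := by
    cases subsingleton_or_nontrivial R
    · -- over the zero ring all degrees vanish
      rw [Subsingleton.elim f 0, natDegree_zero, eq_comm, Finset.sum_eq_zero_iff] at hn
      rw [Subsingleton.elim (Polynomial.map _ _) 0, natDegree_zero, hn i (Finset.mem_univ i)]
    · exact natDegree_map_invBlockPoly _ _ _ _ _
  prod_eq := by
    rw [prod_map_youngPoly, φ.extends_ferrand, map_ferrand_symPoly_root hf]

theorem MonicFactorization.ext_factor {F F' : MonicFactorization f n}
    (h : F.factor = F'.factor) : F = F' := by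
  cases F
  cases F'
  cases h
  rfl

theorem ClosureDatum.toFactorization_injective (hf : f.Monic) (hn : f.natDegree = ∑ i, n i) :
    Function.Injective (ClosureDatum.toFactorization (n := n) hf hn) := by
  intro φ ψ h
  have : φ.toAlgHom = ψ.toAlgHom :=
    young_algHom_ext hf fun i => congrFun (congrArg MonicFactorization.factor h) i
  cases φ
  cases ψ
  simpa using this

/-- Evaluation at roots of the `f_i` in a faithful algebra in which they split takes values in `R`
on the invariants, because the generators of the invariants go to the coefficients of the `f_i`. -/
theorem MonicFactorization.exists_algHom (hf : f.Monic) (F : MonicFactorization f n) :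
    ∃ φ : invariants R (AdjoinRoot f) (youngSubgroup n) →ₐ[R] R,
      ∀ i, (youngPoly f n i).map φ.toRingHom = F.factor i := by
  obtain ⟨S, _, _, r, hS, hr⟩ :=
    exists_faithful_splitting_family F.factor F.monic F.natDegree_eq
  have hroot : ∀ i j, aeval (r i j) f = 0 := by
    intro i j
    rw [← F.prod_eq, map_prod]
    refine Finset.prod_eq_zero (Finset.mem_univ i) ?_
    rw [aeval_def, ← eval_map, hr, eval_prod]
    exact Finset.prod_eq_zero (Finset.mem_univ j) (by simp)
  let ev : (p : Σ i, Fin (n i)) → AdjoinRoot f →ₐ[R] S := fun p =>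
    AdjoinRoot.liftAlgHom f (Algebra.ofId R S) (r p.1 p.2) (hroot p.1 p.2)
  let χ : (⨂[R] _ : Fin (∑ i, n i), AdjoinRoot f) →ₐ[R] S :=
    liftFamily fun l => ev (finSigmaFinEquiv.symm l)
  have hχ : ∀ l a, χ (PiTensorProduct.singleAlgHom (R := R)
      (A := fun _ : Fin (∑ i, n i) => AdjoinRoot f) l a) = ev (finSigmaFinEquiv.symm l) a :=
    fun l a => liftFamily_single _ _ _
  set ψ := χ.comp (invariants R (AdjoinRoot f) (youngSubgroup n)).val with hψ
  have hψi : ∀ i, (youngPoly f n i).map ψ.toRingHom = (F.factor i).map (algebraMap R S) := by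
    intro i
    rw [hψ, map_comp_val_youngPoly, hr]
    refine Finset.prod_congr rfl fun j _ => ?_
    rw [hχ, blockPos, Equiv.symm_apply_apply]
    exact congrArg (fun y => X - C y) (AdjoinRoot.liftAlgHom_root (p := f) _ _ _)
  have hrange : ∀ α, ψ α ∈ (⊥ : Subalgebra R S) := by
    have h := eq_top_of_coeff_invBlockPoly_mem finSigmaFinEquiv (mem_youngSubgroup n)
      (AdjoinRoot.powerBasis' hf) ((⊥ : Subalgebra R S).comap ψ) (fun i l => by
        have := congrArg (fun p => coeff p l) (hψi i)
        simp only [coeff_map] at this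
        rw [AdjoinRoot.powerBasis'_gen]
        exact Algebra.mem_bot.2 ⟨_, this.symm⟩)
    intro α
    exact (h ▸ Algebra.mem_top : α ∈ (⊥ : Subalgebra R S).comap ψ)
  refine ⟨((Algebra.botEquivOfInjective hS).toAlgHom).comp (ψ.codRestrict ⊥ hrange), fun i => ?_⟩
  apply Polynomial.map_injective _ hS
  rw [← hψi, Polynomial.map_map]
  congr 1
  ext α
  exact congrArg Subtype.val ((Algebra.botEquivOfInjective hS).symm_apply_apply ⟨ψ α, hrange α⟩)

theorem ClosureDatum.toFactorization_surjective (hf : f.Monic) (hn : f.natDegree = ∑ i, n i) :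
    Function.Surjective (ClosureDatum.toFactorization (n := n) hf hn) := by
  intro F
  obtain ⟨φ, hφ⟩ := F.exists_algHom hf
  refine ⟨⟨φ, symmetric_adjoinRoot_algHom_ext hf ?_⟩, ?_⟩
  · rw [← prod_map_youngPoly, map_ferrand_symPoly_root hf]
    simp only [hφ, F.prod_eq]
  · exact MonicFactorization.ext_factor (_root_.funext hφ)

end Monogenic

/-! ### The homomorphism attached to a factorization -/

section Attached

variable {R : Type*} [CommRing R] {f : R[X]} {k : ℕ} {n : Fin k → ℕ}

theorem map_mapInvariants_symPoly {A B : Type*} [CommRing A] [Algebra R A] [CommRing B]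
    [Algebra R B] (d : ℕ) (p : A →ₐ[R] B) (x : A) :
    (symPoly R d x).map (mapInvariants p (⊤ : Subgroup (Equiv.Perm (Fin d)))).toRingHom =
      symPoly R d (p x) := by
  apply map_val_injective
  rw [map_val_symPoly, Polynomial.map_map]
  refine (map_comp_val_symPoly d x (tensorMap p id)).trans ?_
  simp only [tensorMap_single, id]

theorem tensorMap_blockPos_mem_invariants (hf : f.Monic) (i : Fin k)
    (α : invariants R (AdjoinRoot f) (⊤ : Subgroup (Equiv.Perm (Fin (n i))))) :
    tensorMap (AlgHom.id R (AdjoinRoot f)) (blockPos n i)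
      (α : ⨂[R] _ : Fin (n i), AdjoinRoot f) ∈ invariants R (AdjoinRoot f) (youngSubgroup n) := by
  have h := eq_top_of_coeff_invBlockPoly_mem (singleBlock (n i))
    (mem_top_iff_preserves_singleBlock (n i)) (AdjoinRoot.powerBasis' hf)
    ((invariants R (AdjoinRoot f) (youngSubgroup n)).comap
      ((tensorMap (AlgHom.id R (AdjoinRoot f)) (blockPos n i)).comp (invariants R _ ⊤).val))
    (fun _ l => by
      have hl := congrArg (fun p => coeff p l) ((map_comp_val_symPoly (n i) (AdjoinRoot.root f)
        (tensorMap (AlgHom.id R (AdjoinRoot f)) (blockPos n i))).trans (by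
          simp only [tensorMap_single, AlgHom.id_apply]
          exact (map_val_youngPoly n i).symm))
      simp only [coeff_map] at hl
      rw [AdjoinRoot.powerBasis'_gen]
      change ((tensorMap (AlgHom.id R (AdjoinRoot f)) (blockPos n i)).comp
        (invariants R (AdjoinRoot f) ⊤).val).toRingHom
          ((symPoly R (n i) (AdjoinRoot.root f)).coeff l) ∈
            invariants R (AdjoinRoot f) (youngSubgroup n)
      rw [hl]
      exact ((youngPoly f n i).coeff l).2)
  exact (h ▸ Algebra.mem_top : α ∈ (invariants R (AdjoinRoot f) (youngSubgroup n)).comap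
    ((tensorMap (AlgHom.id R (AdjoinRoot f)) (blockPos n i)).comp (invariants R _ ⊤).val))

/-- Symmetric tensors in the factors of the `i`-th block, as invariants of the Young subgroup. -/
noncomputable def blockInclusion (hf : f.Monic) (n : Fin k → ℕ) (i : Fin k) :
    invariants R (AdjoinRoot f) (⊤ : Subgroup (Equiv.Perm (Fin (n i)))) →ₐ[R]
      invariants R (AdjoinRoot f) (youngSubgroup n) :=
  ((tensorMap (AlgHom.id R (AdjoinRoot f)) (blockPos n i)).comp
    (invariants R _ ⊤).val).codRestrict _ (tensorMap_blockPos_mem_invariants hf i)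

theorem map_blockInclusion_symPoly (hf : f.Monic) (i : Fin k) :
    (symPoly R (n i) (AdjoinRoot.root f)).map (blockInclusion hf n i).toRingHom =
      youngPoly f n i := by
  apply map_val_injective
  rw [map_val_youngPoly, Polynomial.map_map]
  refine (map_comp_val_symPoly (n i) (AdjoinRoot.root f)
    (tensorMap (AlgHom.id R (AdjoinRoot f)) (blockPos n i))).trans ?_
  simp only [tensorMap_single, AlgHom.id_apply]

theorem comp_blockInclusion (hf : f.Monic) (F : MonicFactorization f n)
    {φ : invariants R (AdjoinRoot f) (youngSubgroup n) →ₐ[R] R}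
    (hφ : ∀ i, (youngPoly f n i).map φ.toRingHom = F.factor i) (i : Fin k) :
    φ.comp (blockInclusion hf n i) = (F.ferrandFactor i).comp (mapInvariants (F.proj i) ⊤) := by
  apply symmetric_adjoinRoot_algHom_ext hf
  have h1 := congrArg (Polynomial.map φ.toRingHom) (map_blockInclusion_symPoly (n := n) hf i)
  have h2 := congrArg (Polynomial.map (F.ferrandFactor i).toRingHom)
    (map_mapInvariants_symPoly (n i) (F.proj i) (AdjoinRoot.root f))
  rw [MonicFactorization.proj, AdjoinRoot.algHomOfDvd_root, MonicFactorization.ferrandFactor,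
    map_ferrand_symPoly_root (F.monic i), Polynomial.map_map] at h2
  rw [hφ, Polynomial.map_map] at h1
  exact h1.trans h2.symm

/-- The closure datum whose block polynomials are the `f_i` is the one attached to the
factorization: on each block both sides are homomorphisms with the same value on the generators. -/
theorem MonicFactorization.isAttached (hf : f.Monic) (F : MonicFactorization f n)
    {φ : invariants R (AdjoinRoot f) (youngSubgroup n) →ₐ[R] R}
    (hφ : ∀ i, (youngPoly f n i).map φ.toRingHom = F.factor i) : F.IsAttached φ := by
  intro α
  refine ⟨Subalgebra.prod_mem _ fun i _ => tensorMap_blockPos_mem_invariants hf i (α i), ?_⟩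
  have h : ∀ h', (⟨∏ i, tensorMap (AlgHom.id R (AdjoinRoot f)) (blockPos n i)
      (α i : ⨂[R] _ : Fin (n i), AdjoinRoot f), h'⟩ :
        invariants R (AdjoinRoot f) (youngSubgroup n)) = ∏ i, blockInclusion hf n i (α i) :=
    fun _ => Subtype.ext (map_prod (invariants R (AdjoinRoot f) (youngSubgroup n)).val
      (fun i => blockInclusion hf n i (α i)) Finset.univ).symm
  rw [h, map_prod]
  exact Finset.prod_congr rfl fun i _ => DFunLike.congr_fun (comp_blockInclusion hf F hφ i) (α i)

end Attached

/-! ### The closure algebra -/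

section ClosureAlgebra

variable {R A B : Type*} [CommRing R] [CommRing A] [Algebra R A] [CommRing B] [Algebra R B]
  {d : ℕ} {G : Subgroup (Equiv.Perm (Fin d))} (φ : invariants R A G →ₐ[R] R)

/-- The projection `A^{⊗n} → A^{⊗n}/φ`. -/
noncomputable def closureMk : (⨂[R] _ : Fin d, A) →ₐ[R] ClosureAlgebra φ :=
  Ideal.Quotient.mkₐ R _

theorem closureMk_comp_val :
    (closureMk φ).comp (invariants R A G).val = (Algebra.ofId R (ClosureAlgebra φ)).comp φ := by
  ext α
  exact (Ideal.Quotient.eq).2 (Ideal.subset_span ⟨α, rfl⟩)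

theorem map_ofId_comp (P : (invariants R A G)[X]) :
    P.map ((Algebra.ofId R B).comp φ).toRingHom = (P.map φ.toRingHom).map (algebraMap R B) := by
  rw [Polynomial.map_map]
  rfl

variable {φ}

/-- The universal property of `A^{⊗n}/φ`: it classifies the homomorphisms from `A^{⊗n}` that
restrict to `φ` on the invariants. -/
noncomputable def closureLift (χ : (⨂[R] _ : Fin d, A) →ₐ[R] B)
    (h : χ.comp (invariants R A G).val = (Algebra.ofId R B).comp φ) :
    ClosureAlgebra φ →ₐ[R] B :=
  Ideal.Quotient.liftₐ _ χ fun a ha => by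
    refine (Ideal.span_le (I := RingHom.ker χ)).2 ?_ ha
    rintro _ ⟨α, rfl⟩
    have := DFunLike.congr_fun h α
    simp only [SetLike.mem_coe, RingHom.mem_ker, map_sub, AlgHom.commutes]
    exact sub_eq_zero.2 this

theorem closureLift_mk (χ : (⨂[R] _ : Fin d, A) →ₐ[R] B)
    (h : χ.comp (invariants R A G).val = (Algebra.ofId R B).comp φ) (a : ⨂[R] _ : Fin d, A) :
    closureLift χ h (closureMk φ a) = χ a :=
  rfl

theorem closureAlgebra_algHom_ext {χ ψ : ClosureAlgebra φ →ₐ[R] B}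
    (h : ∀ l a, χ (closureMk φ (PiTensorProduct.singleAlgHom (R := R) (A := fun _ : Fin d => A)
      l a)) = ψ (closureMk φ (PiTensorProduct.singleAlgHom (R := R) (A := fun _ : Fin d => A)
      l a))) : χ = ψ := by
  refine Ideal.Quotient.algHom_ext R ?_
  change χ.comp (closureMk φ) = ψ.comp (closureMk φ)
  exact PiTensorProduct.algHom_ext fun l => AlgHom.ext fun a => h l a

end ClosureAlgebra

section Iso

variable {R : Type*} [CommRing R] {f : R[X]} {k : ℕ} {n : Fin k → ℕ}

theorem map_ferrandFactor_symPoly (F : MonicFactorization f n) (i : Fin k) :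
    (symPoly R (n i) (AdjoinRoot.root (F.factor i))).map (F.ferrandFactor i).toRingHom =
      F.factor i :=
  map_ferrand_symPoly_root (F.monic i) _

theorem prod_closureMk_ferrandFactor (F : MonicFactorization f n) (i : Fin k) :
    ∏ j, (X - C (closureMk (F.ferrandFactor i) (PiTensorProduct.singleAlgHom (R := R)
      (A := fun _ : Fin (n i) => AdjoinRoot (F.factor i)) j (AdjoinRoot.root (F.factor i))))) =
      (F.factor i).map (algebraMap R (ClosureAlgebra (F.ferrandFactor i))) := by
  rw [← map_comp_val_symPoly, closureMk_comp_val, map_ofId_comp, map_ferrandFactor_symPoly]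

theorem prod_closureMk_block (F : MonicFactorization f n)
    {φ : invariants R (AdjoinRoot f) (youngSubgroup n) →ₐ[R] R}
    (hφ : ∀ i, (youngPoly f n i).map φ.toRingHom = F.factor i) (i : Fin k) :
    ∏ j, (X - C (closureMk φ (PiTensorProduct.singleAlgHom (R := R)
      (A := fun _ : Fin (∑ i, n i) => AdjoinRoot f) (blockPos n i j) (AdjoinRoot.root f)))) =
      (F.factor i).map (algebraMap R (ClosureAlgebra φ)) := by
  rw [← map_comp_val_youngPoly, closureMk_comp_val, map_ofId_comp, hφ]

/-- The homomorphism `R[x]/(f_i) → A^{⊗n}/φ` sending `x` to the class of `x^{(j)}`, for a position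
`j` of the `i`-th block. -/
noncomputable def factorToClosure (F : MonicFactorization f n)
    {φ : invariants R (AdjoinRoot f) (youngSubgroup n) →ₐ[R] R}
    (hφ : ∀ i, (youngPoly f n i).map φ.toRingHom = F.factor i) (i : Fin k) (j : Fin (n i)) :
    AdjoinRoot (F.factor i) →ₐ[R] ClosureAlgebra φ :=
  AdjoinRoot.liftAlgHom (F.factor i) (Algebra.ofId R _)
    (closureMk φ (PiTensorProduct.singleAlgHom (R := R)
      (A := fun _ : Fin (∑ i, n i) => AdjoinRoot f) (blockPos n i j) (AdjoinRoot.root f))) (by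
    change eval₂ (algebraMap R (ClosureAlgebra φ)) _ _ = 0
    rw [← eval_map, ← prod_closureMk_block F hφ, eval_prod]
    exact Finset.prod_eq_zero (Finset.mem_univ j) (by
      simp [-PiTensorProduct.singleAlgHom_apply]))

theorem factorToClosure_root (F : MonicFactorization f n)
    {φ : invariants R (AdjoinRoot f) (youngSubgroup n) →ₐ[R] R}
    (hφ : ∀ i, (youngPoly f n i).map φ.toRingHom = F.factor i) (i : Fin k) (j : Fin (n i)) :
    factorToClosure F hφ i j (AdjoinRoot.root (F.factor i)) =
      closureMk φ (PiTensorProduct.singleAlgHom (R := R)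
        (A := fun _ : Fin (∑ i, n i) => AdjoinRoot f) (blockPos n i j) (AdjoinRoot.root f)) :=
  AdjoinRoot.liftAlgHom_root _ _ _ _

/-- The homomorphism `A_i^{⊗n_i}/Ferrand → A^{⊗n}/φ` given by the positions of the `i`-th block. -/
noncomputable def factorClosureToClosure (F : MonicFactorization f n)
    {φ : invariants R (AdjoinRoot f) (youngSubgroup n) →ₐ[R] R}
    (hφ : ∀ i, (youngPoly f n i).map φ.toRingHom = F.factor i) (i : Fin k) :
    ClosureAlgebra (F.ferrandFactor i) →ₐ[R] ClosureAlgebra φ :=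
  closureLift (liftFamily (factorToClosure F hφ i)) (by
    apply symmetric_adjoinRoot_algHom_ext (F.monic i)
    rw [map_comp_val_symPoly, map_ofId_comp, map_ferrandFactor_symPoly]
    simp only [liftFamily_single, factorToClosure_root]
    exact prod_closureMk_block F hφ i)

theorem factorClosureToClosure_root (F : MonicFactorization f n)
    {φ : invariants R (AdjoinRoot f) (youngSubgroup n) →ₐ[R] R}
    (hφ : ∀ i, (youngPoly f n i).map φ.toRingHom = F.factor i) (i : Fin k) (j : Fin (n i)) :
    factorClosureToClosure F hφ i (closureMk (F.ferrandFactor i)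
      (PiTensorProduct.singleAlgHom (R := R) (A := fun _ : Fin (n i) => AdjoinRoot (F.factor i)) j
        (AdjoinRoot.root (F.factor i)))) =
      closureMk φ (PiTensorProduct.singleAlgHom (R := R)
        (A := fun _ : Fin (∑ i, n i) => AdjoinRoot f) (blockPos n i j) (AdjoinRoot.root f)) := by
  rw [factorClosureToClosure, closureLift_mk, liftFamily_single, factorToClosure_root]

-- The algebras `A_i^{⊗n_i}/Ferrand` enter through isomorphic copies `D_i` with abstract ring
-- structures: unifying the instances on a tensor product of explicit quotients is very slow.
variable {D : Fin k → Type*} [∀ i, CommRing (D i)] [∀ i, Algebra R (D i)]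
  (F : MonicFactorization f n) (ε : ∀ i, ClosureAlgebra (F.ferrandFactor i) ≃ₐ[R] D i)

/-- The homomorphism `A_i → A_i^{⊗n_i}/Ferrand` that sends `a` to the class of `a^{(j)}`. -/
noncomputable def factorComponent (i : Fin k) (j : Fin (n i)) :
    AdjoinRoot (F.factor i) →ₐ[R] D i :=
  (ε i).toAlgHom.comp ((closureMk (F.ferrandFactor i)).comp
    (PiTensorProduct.singleAlgHom (R := R) (A := fun _ => AdjoinRoot (F.factor i)) j))

theorem prod_factorComponent (i : Fin k) :
    ∏ j, (X - C (factorComponent F ε i j (AdjoinRoot.root (F.factor i)))) =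
      (F.factor i).map (algebraMap R (D i)) := by
  have h := congrArg (Polynomial.map (ε i).toAlgHom.toRingHom) (prod_closureMk_ferrandFactor F i)
  rw [Polynomial.map_map, Polynomial.map_prod] at h
  refine Eq.trans (Finset.prod_congr rfl fun j _ => ?_) (h.trans ?_)
  · rw [Polynomial.map_sub, map_X, map_C]
    rfl
  · exact congrArg (fun g => Polynomial.map g (F.factor i))
      (RingHom.ext fun r => (ε i).toAlgHom.commutes r)

/-- The homomorphism `A^{⊗n} → ⨂ A_i^{⊗n_i}/Ferrand` that projects `A` to `A_i` in the positions
of the `i`-th block. -/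
noncomputable def tensorPowerToTensor :
    (⨂[R] _ : Fin (∑ i, n i), AdjoinRoot f) →ₐ[R] ⨂[R] i, D i :=
  liftFamily fun l => ((PiTensorProduct.singleAlgHom (R := R) (A := D)
    (finSigmaFinEquiv.symm l).1).comp (factorComponent F ε _ (finSigmaFinEquiv.symm l).2)).comp
      (F.proj _)

theorem tensorPowerToTensor_blockPos_root (i : Fin k) (j : Fin (n i)) :
    tensorPowerToTensor F ε (PiTensorProduct.singleAlgHom (R := R)
      (A := fun _ : Fin (∑ i, n i) => AdjoinRoot f) (blockPos n i j) (AdjoinRoot.root f)) =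
      PiTensorProduct.singleAlgHom (R := R) (A := D) i
        (factorComponent F ε i j (AdjoinRoot.root (F.factor i))) := by
  rw [tensorPowerToTensor, liftFamily_single, blockPos, Equiv.symm_apply_apply,
    AlgHom.comp_apply, AlgHom.comp_apply, MonicFactorization.proj, AdjoinRoot.algHomOfDvd_root]

theorem tensorPowerToTensor_comp_val (hf : f.Monic)
    {φ : invariants R (AdjoinRoot f) (youngSubgroup n) →ₐ[R] R}
    (hφ : ∀ i, (youngPoly f n i).map φ.toRingHom = F.factor i) :
    (tensorPowerToTensor F ε).comp (invariants R (AdjoinRoot f) (youngSubgroup n)).val =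
      (Algebra.ofId R (⨂[R] i, D i)).comp φ := by
  apply young_algHom_ext hf
  intro i
  rw [map_comp_val_youngPoly, map_ofId_comp, hφ]
  simp only [tensorPowerToTensor_blockPos_root]
  have h := congrArg (Polynomial.map (PiTensorProduct.singleAlgHom (R := R)
    (A := D) i).toRingHom) (prod_factorComponent F ε i)
  rw [Polynomial.map_map, Polynomial.map_prod] at h
  refine Eq.trans (Finset.prod_congr rfl fun j _ => ?_) (h.trans ?_)
  · rw [Polynomial.map_sub, map_X, map_C]
    rfl
  · exact congrArg (fun g => Polynomial.map g (F.factor i))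
      (RingHom.ext fun r =>
        (PiTensorProduct.singleAlgHom (R := R) (A := D) i).commutes r)

/-- The homomorphism `⨂ A_i^{⊗n_i}/Ferrand → A^{⊗n}/φ` inverse to the one induced by
`tensorPowerToTensor`. -/
noncomputable def tensorToClosure
    {φ : invariants R (AdjoinRoot f) (youngSubgroup n) →ₐ[R] R}
    (hφ : ∀ i, (youngPoly f n i).map φ.toRingHom = F.factor i) :
    (⨂[R] i, D i) →ₐ[R] ClosureAlgebra φ :=
  liftFamily fun i => (factorClosureToClosure F hφ i).comp (ε i).symm.toAlgHom

theorem tensorToClosure_single_root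
    {φ : invariants R (AdjoinRoot f) (youngSubgroup n) →ₐ[R] R}
    (hφ : ∀ i, (youngPoly f n i).map φ.toRingHom = F.factor i) (i : Fin k) (j : Fin (n i)) :
    tensorToClosure F ε hφ (PiTensorProduct.singleAlgHom (R := R) (A := D) i
      (factorComponent F ε i j (AdjoinRoot.root (F.factor i)))) =
      closureMk φ (PiTensorProduct.singleAlgHom (R := R)
        (A := fun _ : Fin (∑ i, n i) => AdjoinRoot f) (blockPos n i j) (AdjoinRoot.root f)) := by
  rw [tensorToClosure, liftFamily_single, ← factorClosureToClosure_root F hφ]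
  exact congrArg (factorClosureToClosure F hφ i) ((ε i).symm_apply_apply _)

variable {F} in
/-- Homomorphisms out of `⨂ A_i^{⊗n_i}/Ferrand` are determined by the images of the `x^{(j)}`. -/
theorem tensor_algHom_ext {B : Type*} [CommRing B] [Algebra R B]
    {χ ψ : (⨂[R] i, D i) →ₐ[R] B}
    (h : ∀ i j, χ (PiTensorProduct.singleAlgHom (R := R) (A := D) i
      (factorComponent F ε i j (AdjoinRoot.root (F.factor i)))) =
      ψ (PiTensorProduct.singleAlgHom (R := R) (A := D) i
      (factorComponent F ε i j (AdjoinRoot.root (F.factor i))))) : χ = ψ := by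
  refine PiTensorProduct.algHom_ext fun i => ?_
  have h' : (χ.comp (PiTensorProduct.singleAlgHom (R := R) (A := D) i)).comp (ε i).toAlgHom =
      (ψ.comp (PiTensorProduct.singleAlgHom (R := R) (A := D) i)).comp (ε i).toAlgHom :=
    closureAlgebra_algHom_ext fun j => DFunLike.congr_fun (AdjoinRoot.algHom_ext
      (g₁ := (χ.comp (PiTensorProduct.singleAlgHom (R := R) (A := D) i)).comp
        (factorComponent F ε i j))
      (g₂ := (ψ.comp (PiTensorProduct.singleAlgHom (R := R) (A := D) i)).comp
        (factorComponent F ε i j)) (h i j))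
  ext d
  obtain ⟨c, rfl⟩ := (ε i).surjective d
  exact DFunLike.congr_fun h' c

theorem closure_algHom_ext_root {B : Type*} [CommRing B] [Algebra R B]
    {φ : invariants R (AdjoinRoot f) (youngSubgroup n) →ₐ[R] R} {χ ψ : ClosureAlgebra φ →ₐ[R] B}
    (h : ∀ i j, χ (closureMk φ (PiTensorProduct.singleAlgHom (R := R)
        (A := fun _ : Fin (∑ i, n i) => AdjoinRoot f) (blockPos n i j) (AdjoinRoot.root f))) =
      ψ (closureMk φ (PiTensorProduct.singleAlgHom (R := R)
        (A := fun _ : Fin (∑ i, n i) => AdjoinRoot f) (blockPos n i j) (AdjoinRoot.root f)))) :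
    χ = ψ := by
  refine closureAlgebra_algHom_ext fun l => ?_
  obtain ⟨⟨i, j⟩, rfl⟩ := finSigmaFinEquiv.surjective l
  exact DFunLike.congr_fun (AdjoinRoot.algHom_ext
    (g₁ := χ.comp ((closureMk φ).comp (PiTensorProduct.singleAlgHom (R := R)
        (A := fun _ : Fin (∑ i, n i) => AdjoinRoot f) (blockPos n i j))))
    (g₂ := ψ.comp ((closureMk φ).comp (PiTensorProduct.singleAlgHom (R := R)
        (A := fun _ : Fin (∑ i, n i) => AdjoinRoot f) (blockPos n i j)))) (h i j))

/-- Both algebras are generated by the classes of the `x^{(j)}`, subject to the condition that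
over the `i`-th block `∏ (λ - x^{(j)})` equals `f_i`. -/
noncomputable def closureAlgebraEquiv (hf : f.Monic)
    {φ : invariants R (AdjoinRoot f) (youngSubgroup n) →ₐ[R] R}
    (hφ : ∀ i, (youngPoly f n i).map φ.toRingHom = F.factor i) :
    ClosureAlgebra φ ≃ₐ[R] ⨂[R] i, D i :=
  AlgEquiv.ofAlgHom
    (closureLift (tensorPowerToTensor F ε) (tensorPowerToTensor_comp_val F ε hf hφ))
    (tensorToClosure F ε hφ)
    (tensor_algHom_ext ε fun i j => by
      rw [AlgHom.comp_apply, tensorToClosure_single_root, closureLift_mk,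
        tensorPowerToTensor_blockPos_root, AlgHom.id_apply])
    (closure_algHom_ext_root fun i j => by
      rw [AlgHom.comp_apply, closureLift_mk, tensorPowerToTensor_blockPos_root,
        tensorToClosure_single_root, AlgHom.id_apply])

end Iso

end ClosureData

theorem mainTheorem4 {R : Type*} [CommRing R] (f : R[X]) (hf : f.Monic)
    {k : ℕ} (n : Fin k → ℕ) (hn : f.natDegree = ∑ i, n i) :
    ∃ Φ : ClosureDatum (isFreeOfRank_adjoinRoot hf hn) (youngSubgroup n) ≃
        MonicFactorization f n,
      (∀ (φ : ClosureDatum (isFreeOfRank_adjoinRoot hf hn) (youngSubgroup n)) (i : Fin k),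
        IsBlockPolynomial φ.toAlgHom i ((Φ φ).factor i)) ∧
      ∀ F : MonicFactorization f n,
        F.IsAttached (Φ.symm F).toAlgHom ∧
        Nonempty (ClosureAlgebra (Φ.symm F).toAlgHom ≃ₐ[R]
          ⨂[R] i : Fin k, ClosureAlgebra (F.ferrandFactor i)) := by
  obtain ⟨Φ, hΦ⟩ : ∃ Φ : ClosureDatum (isFreeOfRank_adjoinRoot hf hn) (youngSubgroup n) ≃
      MonicFactorization f n, ∀ φ, Φ φ = φ.toFactorization hf hn :=
    ⟨Equiv.ofBijective _ ⟨ClosureDatum.toFactorization_injective hf hn,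
      ClosureDatum.toFactorization_surjective hf hn⟩, fun _ => rfl⟩
  refine ⟨Φ, fun φ i => ⟨youngPoly f n i, map_val_youngPoly n i, by rw [hΦ]; rfl⟩, fun F => ?_⟩
  have hφ : ∀ i, (youngPoly f n i).map (Φ.symm F).toAlgHom.toRingHom = F.factor i := fun i =>
    congrFun (congrArg MonicFactorization.factor ((hΦ _).symm.trans (Φ.apply_symm_apply F))) i
  exact ⟨F.isAttached hf hφ, ⟨closureAlgebraEquiv F (fun _ => AlgEquiv.refl) hf hφ⟩⟩
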